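/- Let $\mu$ be a partition, with size $|\mu|$, conjugate $\mu^t$, and Young diagram consisting of the boxes $\square=(i,j)$, $1\le j\le \mu_i$. The content of $\square=(i,j)$ is $c(\square)=j-i$; its hook length is the number of boxes $(i,j')\in\mu$ with $j'\ge j$ or $(i',j)\in\mu$ with $i'\ge i$; $h_\mu$ is the product of all hook lengths of $\mu$; and $z\uparrow\mu:=\prod_{\square\in\mu}(z+c(\square))$. Let $\mathfrak{s}_\mu$ and $\mathfrak{s}^*_\mu$ be the Schur function and the (Okounkov–Olshanski) shifted Schur function in variables $x_1,x_2,\dots$; that is, for $n\ge \ell(\mu)$, \[ \mathfrak{s}_\mu(x_1,\dots,x_n,0,0,\dots)=\frac{\det\left[x_i^{\mu_j+n-j}\right]_{i,j=1}^n}{\det\left[x_i^{n-j}\right]_{i,j=1}^n}, \qquad \mathfrak{s}^*_\mu(x_1,\dots,x_n,0,0,\dots)=\frac{\det\left[(x_i+n-i)\downarrow(\mu_j+n-j)\right]_{i,j=1}^n}{\det\left[(x_i+n-i)\downarrow(n-j)\right]_{i,j=1}^n}, \] both quotients being polynomials in $x_1,\dots,x_n$, where $x\downarrow m=x(x-1)\cdots(x-m+1)$.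 For a nonnegative integer $k$ write $\{a\}^k$ for the sequence of $k$ copies of $a$ followed by infinitely many zeros. Then, for all nonnegative integers $N$ and $k$, \begin{align*} \mathfrak{s}^*_\mu\left(\{N\}^k\right)&=h_\mu\cdot\mathfrak{s}_{\mu^t}\left(\{1\}^N\right)\cdot\mathfrak{s}_\mu\left(\{1\}^k\right)\\ &=(-1)^{|\mu|}\,\frac{\left((-N)\uparrow\mu\right)\left(k\uparrow\mu\right)}{h_\mu}\\ &=\left(\prod_{\square\in\mu}\left(N-c(\square)\right)\right)\mathfrak{s}_\mu\left(\{1\}^k\right). \end{align*} -/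

import Mathlib

noncomputable section

namespace ShiftedSchur

/-! ### Boxes of a partition

A partition is a `YoungDiagram`; `μ.rowLen i` is its part number `i` (rows and columns are
numbered from `0`), `μ.colLen 0` is its length, `μ.card` its size, `μ.transpose` its conjugate. -/

/-- The content `j - i` of the box in row `i` and column `j`. -/
def content (c : ℕ × ℕ) : ℤ := (c.2 : ℤ) - (c.1 : ℤ)

/-- `z ↑ μ`, the product of `z + c(□)` over the boxes `□` of `μ`. -/
def risingProd (z : ℚ) (μ : YoungDiagram) : ℚ := ∏ c ∈ μ.cells, (z + (content c : ℚ))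

/-- The hook of a box `c`: the boxes of `μ` in the row of `c`, weakly to its right, together with
those in the column of `c`, weakly below it. -/
def hook (μ : YoungDiagram) (c : ℕ × ℕ) : Finset (ℕ × ℕ) :=
  {d ∈ μ.cells | d.1 = c.1 ∧ c.2 ≤ d.2} ∪ {d ∈ μ.cells | d.2 = c.2 ∧ c.1 ≤ d.1}

/-- The hook number `h_μ`, the product of all hook lengths. -/
def hookNumber (μ : YoungDiagram) : ℕ := ∏ c ∈ μ.cells, (hook μ c).card

/-! ### The alternants -/

/-- `det [x_i ^ (a_j + n - j)]` (with `i`, `j` from `1` to `n`); `j.rev` is `n - j`. -/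
def schurAlternant (n : ℕ) (a : ℕ → ℕ) : MvPolynomial (Fin n) ℚ :=
  Matrix.det (Matrix.of fun i j : Fin n =>
    (MvPolynomial.X i : MvPolynomial (Fin n) ℚ) ^ (a j + (j.rev : ℕ)))

/-- `det [(x_i + n - i) ↓ (a_j + n - j)]` (with `i`, `j` from `1` to `n`), where
`x ↓ m = x (x - 1) ⋯ (x - m + 1)` is the falling factorial. -/
def shiftedAlternant (n : ℕ) (a : ℕ → ℕ) : MvPolynomial (Fin n) ℚ :=
  Matrix.det (Matrix.of fun i j : Fin n =>
    (descPochhammer (MvPolynomial (Fin n) ℚ) (a j + (j.rev : ℕ))).eval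
      (MvPolynomial.X i + ((i.rev : ℕ) : MvPolynomial (Fin n) ℚ)))

/-! ### Divisibility of the alternants, and their behaviour when a variable is set to zero -/

section Alternants

open MvPolynomial

/-- The common form of both kinds of alternants. -/
def alt {R : Type*} [CommRing R] {n : ℕ} (p : ℕ → Polynomial R) (y : Fin n → R) (a : ℕ → ℕ) : R :=
  Matrix.det (Matrix.of fun i j : Fin n => (p (a j + (j.rev : ℕ))).eval (y i))

theorem sub_dvd_det {R : Type*} [CommRing R] {n : ℕ} (p : Fin n → Polynomial R) (y : Fin n → R)
    {i j : Fin n} (hij : i ≠ j) :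
    y j - y i ∣ Matrix.det (Matrix.of fun i k : Fin n => (p k).eval (y i)) := by
  set M : Matrix (Fin n) (Fin n) R := Matrix.of fun i k : Fin n => (p k).eval (y i) with hM
  have h := Matrix.det_updateRow_add_smul_self M hij.symm (-1)
  choose v hv using fun k => Polynomial.sub_dvd_eval_sub (y j) (y i) (p k)
  have h2 : M j + (-1 : R) • M i = (y j - y i) • v := by
    funext k
    have := hv k
    simp only [hM, Pi.add_apply, Pi.smul_apply, Matrix.of_apply, smul_eq_mul]
    rw [← this]; ring
  rw [h2, Matrix.det_updateRow_smul] at h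
  exact ⟨_, h.symm⟩

theorem isRelPrime_sub {n : ℕ} {i j i' j' : Fin n} (h : i < j) (h' : i' < j')
    (hne : (i, j) ≠ (i', j')) :
    IsRelPrime (X j - X i : MvPolynomial (Fin n) ℚ) (X j' - X i') := by
  have hirr : Irreducible (X j - X i : MvPolynomial (Fin n) ℚ) := by
    apply irreducible_of_totalDegree_eq_one
    · apply le_antisymm
      · refine (totalDegree_sub _ _).trans ?_
        simp
      · by_contra hlt
        have h0 : (X j - X i : MvPolynomial (Fin n) ℚ).totalDegree = 0 := by omega
        rw [totalDegree_eq_zero_iff_eq_C] at h0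
        have e1 := congrArg (eval (fun a => if a = j then (1 : ℚ) else 0)) h0
        have e2 := congrArg (eval (fun _ => (0 : ℚ))) h0
        simp only [map_sub, eval_X, eval_C] at e1 e2
        rw [← e2] at e1
        simp [h.ne] at e1
    · intro x hx
      have := hx (Finsupp.single j 1)
      rw [isUnit_iff_ne_zero]
      rintro rfl
      rw [zero_dvd_iff] at this
      simp [coeff_X, Finsupp.single_left_inj, h.ne] at this
  rw [hirr.isRelPrime_iff_not_dvd]
  rintro ⟨q, hq⟩
  have e := congrArg (eval (fun a : Fin n => if a = i ∨ a = j then (0 : ℚ) else (a : ℕ) + 1)) hq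
  simp only [map_sub, map_mul, eval_X, true_or, or_true, if_true, sub_self, zero_mul] at e
  apply hne
  have hi' := h'.ne
  have hv : ((i' : ℕ)) ≠ (j' : ℕ) := fun hh => hi' (Fin.ext hh)
  have hp : ∀ m : ℕ, (m : ℚ) + 1 ≠ 0 := fun m => by positivity
  split_ifs at e with h1 h2 h2
  · rcases h1 with rfl | rfl <;> rcases h2 with rfl | rfl
    · exact absurd rfl hi'
    · exact absurd h' (lt_asymm h)
    · rfl
    · exact absurd rfl hi'
  · exact absurd (by linarith) (hp i')
  · exact absurd (by linarith) (hp j')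
  · exact absurd (by exact_mod_cast (by linarith : ((i' : ℕ) : ℚ) = (j' : ℕ))) hv

theorem vandermonde_dvd {n : ℕ} (p : Fin n → Polynomial (MvPolynomial (Fin n) ℚ)) :
    Matrix.det (Matrix.vandermonde (X : Fin n → MvPolynomial (Fin n) ℚ)) ∣
      Matrix.det (Matrix.of fun i k : Fin n => (p k).eval (X i)) := by
  rw [Matrix.det_vandermonde, Finset.prod_sigma']
  apply Finset.prod_dvd_of_isRelPrime
  · rintro ⟨i, j⟩ hij ⟨i', j'⟩ hij' hne
    simp only [Finset.coe_sigma, Set.mem_sigma_iff, Finset.mem_coe, Finset.mem_Ioi] at hij hij'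
    apply isRelPrime_sub hij.2 hij'.2
    intro h
    apply hne
    rw [Prod.mk.injEq] at h
    obtain ⟨rfl, rfl⟩ := h
    rfl
  · rintro ⟨i, j⟩ hij
    simp only [Finset.mem_sigma, Finset.mem_Ioi] at hij
    exact sub_dvd_det p _ hij.2.ne

theorem alt_zero {R : Type*} [CommRing R] [IsDomain R] {n : ℕ} (p : ℕ → Polynomial R)
    (hm : ∀ m, (p m).Monic) (hd : ∀ m, (p m).natDegree = m) (y : Fin n → R) :
    alt p y (fun _ => 0) =
      ((Equiv.Perm.sign (Fin.revPerm : Equiv.Perm (Fin n)) : ℤ) : R) *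
        Matrix.det (Matrix.vandermonde y) := by
  rw [Matrix.det_eval_matrixOfPolynomials_eq_det_vandermonde y (fun i => p i)
    (fun i => hd i) (fun i => hm i), ← Matrix.det_permute']
  unfold alt
  congr 1
  ext i j
  simp

theorem alt_zero_ne_zero {R : Type*} [CommRing R] [IsDomain R] {n : ℕ} (p : ℕ → Polynomial R)
    (hm : ∀ m, (p m).Monic) (hd : ∀ m, (p m).natDegree = m) (y : Fin n → R)
    (hy : Function.Injective y) : alt p y (fun _ => 0) ≠ 0 := by
  rw [alt_zero p hm hd]
  refine mul_ne_zero ?_ (Matrix.det_vandermonde_ne_zero_iff.mpr hy)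
  rcases Int.units_eq_one_or (Equiv.Perm.sign (Fin.revPerm : Equiv.Perm (Fin n))) with h | h <;>
    simp [h]

theorem alt_zero_dvd {n : ℕ} (p : ℕ → Polynomial ℚ)
    (hm : ∀ m, (p m).Monic) (hd : ∀ m, (p m).natDegree = m) (b : Fin n → ℚ) (a : ℕ → ℕ) :
    alt (fun m => (p m).map (C : ℚ →+* MvPolynomial (Fin n) ℚ)) (fun i => X i + C (b i))
        (fun _ => 0) ∣
      alt (fun m => (p m).map (C : ℚ →+* MvPolynomial (Fin n) ℚ)) (fun i => X i + C (b i)) a := by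
  have hX : alt (fun m => (p m).map (C : ℚ →+* MvPolynomial (Fin n) ℚ)) X (fun _ => 0) ∣
      alt (fun m => (p m).map (C : ℚ →+* MvPolynomial (Fin n) ℚ)) X a := by
    rw [alt_zero _ (fun m => (hm m).map C)
      (fun m => by rw [(hm m).natDegree_map, hd])]
    refine IsUnit.mul_left_dvd ?_ |>.mpr (vandermonde_dvd _)
    rcases Int.units_eq_one_or (Equiv.Perm.sign (Fin.revPerm : Equiv.Perm (Fin n))) with h | h <;>
      simp [h]
  have key : ∀ a : ℕ → ℕ, (bind₁ (fun i => X i + C (b i)) : MvPolynomial (Fin n) ℚ →ₐ[ℚ] _)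
      (alt (fun m => (p m).map (C : ℚ →+* MvPolynomial (Fin n) ℚ)) X a) =
      alt (fun m => (p m).map (C : ℚ →+* MvPolynomial (Fin n) ℚ)) (fun i => X i + C (b i)) a := by
    intro a
    unfold alt
    rw [AlgHom.map_det]
    congr 1
    ext1 i j
    simp only [AlgHom.mapMatrix_apply, Matrix.map_apply, Matrix.of_apply, Polynomial.eval_map]
    have := Polynomial.hom_eval₂ (p (a j + (j.rev : ℕ))) (C : ℚ →+* MvPolynomial (Fin n) ℚ)
      (bind₁ (fun i => X i + C (b i)) : MvPolynomial (Fin n) ℚ →ₐ[ℚ] _).toRingHom (X i)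
    have hc : (bind₁ (fun i => X i + C (b i)) : MvPolynomial (Fin n) ℚ →ₐ[ℚ] _).toRingHom.comp
        (C : ℚ →+* MvPolynomial (Fin n) ℚ) = C := by
      ext x; simp
    rw [hc] at this
    simpa using this
  have := map_dvd (bind₁ (fun i => X i + C (b i)) : MvPolynomial (Fin n) ℚ →ₐ[ℚ] _) hX
  rwa [key, key] at this

theorem alt_succ {R : Type*} [CommRing R] {n : ℕ} (p : ℕ → Polynomial R) (y : Fin n → R)
    (y' : Fin (n + 1) → R) (hlast : y' (Fin.last n) = 0) (h0 : p 0 = 1)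
    (hz : ∀ m, (p (m + 1)).eval 0 = 0)
    (hs : ∀ m i, (p (m + 1)).eval (y' (Fin.castSucc i)) =
      y' (Fin.castSucc i) * (p m).eval (y i))
    (a : ℕ → ℕ) (ha : a n = 0) :
    alt p y' a = (∏ i, y' (Fin.castSucc i)) * alt p y a := by
  unfold alt
  rw [Matrix.det_succ_row _ (Fin.last n), Finset.sum_eq_single (Fin.last n)]
  · rw [← Matrix.det_mul_column]
    have e1 : (-1 : R) ^ (((Fin.last n : Fin (n + 1)) : ℕ) + ((Fin.last n : Fin (n + 1)) : ℕ)) = 1 :=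
      Even.neg_one_pow ⟨_, rfl⟩
    rw [e1]
    simp only [Matrix.of_apply, Fin.val_last, ha, Fin.rev_last, Fin.val_zero, add_zero, h0,
      Polynomial.eval_one, one_mul]
    congr 1
    ext i j
    have hr : a (j : ℕ) + (((Fin.castSucc j).rev : Fin (n + 1)) : ℕ) =
        (a (j : ℕ) + (j.rev : ℕ)) + 1 := by
      have := j.isLt
      simp only [Fin.val_rev, Fin.val_castSucc]
      omega
    simp only [Matrix.submatrix_apply, Matrix.of_apply, Fin.succAbove_last, Fin.val_castSucc]
    rw [hr, hs]
  · intro j _ hj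
    have hr : a (j : ℕ) + ((j.rev : Fin (n + 1)) : ℕ) =
        (a (j : ℕ) + ((j.rev : Fin (n + 1)) : ℕ) - 1) + 1 := by
      have := j.isLt
      have : (j : ℕ) ≠ n := fun h => hj (Fin.ext h)
      simp only [Fin.val_rev]
      omega
    simp only [Matrix.of_apply]
    rw [hr, hlast, hz]
    ring
  · simp

theorem alt_succ_eq_zero {R : Type*} [CommRing R] {n : ℕ} (p : ℕ → Polynomial R)
    (y' : Fin (n + 1) → R) (hlast : y' (Fin.last n) = 0)
    (hz : ∀ m, (p (m + 1)).eval 0 = 0)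
    (a : ℕ → ℕ) (ha : ∀ j ≤ n, a j ≠ 0) :
    alt p y' a = 0 := by
  unfold alt
  apply Matrix.det_eq_zero_of_row_eq_zero (Fin.last n)
  intro j
  have hr : a (j : ℕ) + ((j.rev : Fin (n + 1)) : ℕ) =
      (a (j : ℕ) + ((j.rev : Fin (n + 1)) : ℕ) - 1) + 1 := by
    have := ha j (by omega)
    omega
  simp only [Matrix.of_apply]
  rw [hr, hlast, hz]

/-- Setting the last variable to zero. -/
def setLastZero (n : ℕ) : MvPolynomial (Fin (n + 1)) ℚ →ₐ[ℚ] MvPolynomial (Fin n) ℚ :=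
  aeval (Fin.snoc (α := fun _ => MvPolynomial (Fin n) ℚ) X 0)

theorem setLastZero_X_castSucc {n : ℕ} (i : Fin n) :
    setLastZero n (X (Fin.castSucc i)) = X i := by
  simp [setLastZero]

theorem setLastZero_X_last {n : ℕ} : setLastZero n (X (Fin.last n)) = 0 := by
  simp [setLastZero]

theorem eval_setLastZero {n : ℕ} (x : ℕ → ℚ) (hx : x n = 0) (f : MvPolynomial (Fin (n + 1)) ℚ) :
    eval (fun i : Fin n => x i) (setLastZero n f) = eval (fun i : Fin (n + 1) => x i) f := by
  induction f using MvPolynomial.induction_on with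
  | C r => simp [setLastZero]
  | add f g hf hg => rw [map_add, map_add, map_add, hf, hg]
  | mul_X f i hf =>
    rw [map_mul, map_mul, map_mul, hf]
    congr 1
    refine Fin.lastCases ?_ (fun i => ?_) i
    · simp [setLastZero_X_last, hx]
    · simp [setLastZero_X_castSucc]

theorem map_alt {R S : Type*} [CommRing R] [CommRing S] (f : R →+* S) {n : ℕ}
    (p : ℕ → Polynomial R) (y : Fin n → R) (a : ℕ → ℕ) :
    f (alt p y a) = alt (fun m => (p m).map f) (fun i => f (y i)) a := by
  unfold alt
  rw [RingHom.map_det]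
  congr 1
  ext i j
  simp [Polynomial.eval_map, Polynomial.eval₂_at_apply]

theorem rowLen_ne_zero_iff (μ : YoungDiagram) (i : ℕ) : μ.rowLen i ≠ 0 ↔ i < μ.colLen 0 := by
  rw [← YoungDiagram.mem_iff_lt_colLen, YoungDiagram.mem_iff_lt_rowLen]
  omega

theorem schurAlternant_eq (n : ℕ) (a : ℕ → ℕ) :
    schurAlternant n a =
      alt (fun m => ((Polynomial.X ^ m : Polynomial ℚ)).map (C : ℚ →+* MvPolynomial (Fin n) ℚ))
        (fun i => X i + C 0) a := by
  unfold schurAlternant alt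
  simp

theorem shiftedAlternant_eq (n : ℕ) (a : ℕ → ℕ) :
    shiftedAlternant n a =
      alt (fun m => (descPochhammer ℚ m).map (C : ℚ →+* MvPolynomial (Fin n) ℚ))
        (fun i => X i + C ((i.rev : ℕ) : ℚ)) a := by
  unfold shiftedAlternant alt
  simp

theorem schurAlternant_dvd (n : ℕ) (a : ℕ → ℕ) :
    schurAlternant n (fun _ => 0) ∣ schurAlternant n a := by
  rw [schurAlternant_eq, schurAlternant_eq]
  exact alt_zero_dvd (fun m => Polynomial.X ^ m) (fun m => Polynomial.monic_X_pow m)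
    (fun m => Polynomial.natDegree_X_pow m) (fun _ => 0) a

theorem shiftedAlternant_dvd (n : ℕ) (a : ℕ → ℕ) :
    shiftedAlternant n (fun _ => 0) ∣ shiftedAlternant n a := by
  rw [shiftedAlternant_eq, shiftedAlternant_eq]
  exact alt_zero_dvd (fun m => descPochhammer ℚ m) (fun m => monic_descPochhammer ℚ m)
    (fun m => descPochhammer_natDegree ℚ m) (fun i => ((i.rev : ℕ) : ℚ)) a

theorem X_add_C_injective {n : ℕ} (b : Fin n → ℚ) :
    Function.Injective (fun i => (X i + C (b i) : MvPolynomial (Fin n) ℚ)) := by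
  intro i j h
  by_contra hij
  have e1 := congrArg (eval (fun a => if a = i then (1 : ℚ) else 0)) h
  have e2 := congrArg (eval (fun _ => (0 : ℚ))) h
  have hji : j ≠ i := fun hh => hij hh.symm
  simp only [map_add, eval_X, eval_C, if_true, if_neg hji] at e1 e2
  linarith

theorem schurAlternant_zero_ne_zero (n : ℕ) : schurAlternant n (fun _ => 0) ≠ 0 := by
  rw [schurAlternant_eq]
  exact alt_zero_ne_zero _ (fun m => (Polynomial.monic_X_pow m).map C)
    (fun m => by rw [(Polynomial.monic_X_pow m).natDegree_map, Polynomial.natDegree_X_pow]) _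
    (X_add_C_injective fun _ => 0)

theorem shiftedAlternant_zero_ne_zero (n : ℕ) : shiftedAlternant n (fun _ => 0) ≠ 0 := by
  rw [shiftedAlternant_eq]
  exact alt_zero_ne_zero _ (fun m => (monic_descPochhammer ℚ m).map C)
    (fun m => by rw [(monic_descPochhammer ℚ m).natDegree_map, descPochhammer_natDegree]) _
    (X_add_C_injective _)

end Alternants

/-! ### Schur polynomials and shifted Schur polynomials -/

/-- The Schur polynomial `s_μ(x_1, …, x_n) = det [x_i ^ (μ_j + n - j)] / det [x_i ^ (n - j)]`,
which is zero when `μ` has more than `n` parts. -/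
def schurPoly (n : ℕ) (μ : YoungDiagram) : MvPolynomial (Fin n) ℚ :=
  if μ.colLen 0 ≤ n then Classical.choose (schurAlternant_dvd n μ.rowLen) else 0

/-- The shifted Schur polynomial `s*_μ(x_1, …, x_n)`, that is
`det [(x_i + n - i) ↓ (μ_j + n - j)] / det [(x_i + n - i) ↓ (n - j)]`,
which is zero when `μ` has more than `n` parts. -/
def shiftedSchurPoly (n : ℕ) (μ : YoungDiagram) : MvPolynomial (Fin n) ℚ :=
  if μ.colLen 0 ≤ n then Classical.choose (shiftedAlternant_dvd n μ.rowLen) else 0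

/-- The defining equation of the Schur polynomial; it determines it, as the denominator is not
zero. -/
theorem schurAlternant_mul_schurPoly {n : ℕ} {μ : YoungDiagram} (h : μ.colLen 0 ≤ n) :
    schurAlternant n (fun _ => 0) * schurPoly n μ = schurAlternant n μ.rowLen := by
  rw [schurPoly, if_pos h]
  exact (Classical.choose_spec (schurAlternant_dvd n μ.rowLen)).symm

/-- The defining equation of the shifted Schur polynomial; it determines it, as the denominator is
not zero. -/
theorem shiftedAlternant_mul_shiftedSchurPoly {n : ℕ} {μ : YoungDiagram} (h : μ.colLen 0 ≤ n) :
    shiftedAlternant n (fun _ => 0) * shiftedSchurPoly n μ = shiftedAlternant n μ.rowLen := by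
  rw [shiftedSchurPoly, if_pos h]
  exact (Classical.choose_spec (shiftedAlternant_dvd n μ.rowLen)).symm

/-! ### Stability -/

section Stability

open MvPolynomial

theorem stable_of_alternants {n : ℕ} (μ : YoungDiagram)
    (A : (ℕ → ℕ) → MvPolynomial (Fin (n + 1)) ℚ) (B : (ℕ → ℕ) → MvPolynomial (Fin n) ℚ)
    (P : MvPolynomial (Fin (n + 1)) ℚ) (Q : MvPolynomial (Fin n) ℚ)
    (u : MvPolynomial (Fin n) ℚ) (hu : u ≠ 0) (hB : B (fun _ => 0) ≠ 0)
    (hA1 : ∀ a : ℕ → ℕ, a n = 0 → setLastZero n (A a) = u * B a)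
    (hA2 : ∀ a : ℕ → ℕ, (∀ j ≤ n, a j ≠ 0) → setLastZero n (A a) = 0)
    (hP : μ.colLen 0 ≤ n + 1 → A (fun _ => 0) * P = A μ.rowLen)
    (hP' : ¬ μ.colLen 0 ≤ n + 1 → P = 0)
    (hQ : μ.colLen 0 ≤ n → B (fun _ => 0) * Q = B μ.rowLen)
    (hQ' : ¬ μ.colLen 0 ≤ n → Q = 0) :
    setLastZero n P = Q := by
  have hne : u * B (fun _ => 0) ≠ 0 := mul_ne_zero hu hB
  by_cases h : μ.colLen 0 ≤ n
  · have h0 : μ.rowLen n = 0 := by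
      by_contra hh
      exact absurd ((rowLen_ne_zero_iff μ n).mp hh) (by omega)
    have e := congrArg (setLastZero n) (hP (by omega))
    rw [map_mul, hA1 _ rfl, hA1 _ h0, ← hQ h, ← mul_assoc] at e
    exact mul_left_cancel₀ hne e
  · rw [hQ' h]
    by_cases h1 : μ.colLen 0 ≤ n + 1
    · have e := congrArg (setLastZero n) (hP h1)
      rw [map_mul, hA1 _ rfl,
        hA2 _ (fun j hj => (rowLen_ne_zero_iff μ j).mpr (by omega))] at e
      exact (mul_eq_zero.mp e).resolve_left hne
    · rw [hP' h1, map_zero]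

theorem prod_X_add_C_ne_zero {n : ℕ} (b : Fin n → ℚ) :
    ∏ i, (X i + C (b i) : MvPolynomial (Fin n) ℚ) ≠ 0 := by
  rw [Finset.prod_ne_zero_iff]
  intro i _ h
  have e1 := congrArg (eval (fun _ => 1 - b i)) h
  simp at e1

theorem setLastZero_C {n : ℕ} (r : ℚ) : setLastZero n (C r) = C r := by
  simp [setLastZero]

theorem map_C_setLastZero {n : ℕ} (p : Polynomial ℚ) :
    (p.map (C : ℚ →+* MvPolynomial (Fin (n + 1)) ℚ)).map (setLastZero n : _ →+* _) =
      p.map (C : ℚ →+* MvPolynomial (Fin n) ℚ) := by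
  rw [Polynomial.map_map]
  congr 1
  ext r
  simp [setLastZero_C]

theorem setLastZero_schurPoly (n : ℕ) (μ : YoungDiagram) :
    setLastZero n (schurPoly (n + 1) μ) = schurPoly n μ := by
  have hmap : ∀ a, setLastZero n (schurAlternant (n + 1) a) =
      alt (fun m => ((Polynomial.X ^ m : Polynomial ℚ)).map (C : ℚ →+* MvPolynomial (Fin n) ℚ))
        (fun i : Fin (n + 1) => setLastZero n (X i + C 0)) a := by
    intro a
    rw [schurAlternant_eq]
    have := map_alt (setLastZero n : MvPolynomial (Fin (n + 1)) ℚ →+* MvPolynomial (Fin n) ℚ)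
      (fun m => ((Polynomial.X ^ m : Polynomial ℚ)).map (C : ℚ →+* MvPolynomial (Fin (n + 1)) ℚ))
      (fun i => X i + C 0) a
    simp only [map_C_setLastZero] at this
    exact this
  refine stable_of_alternants μ (schurAlternant (n + 1)) (schurAlternant n) _ _
    (∏ i, (X i + C 0)) (prod_X_add_C_ne_zero fun _ => 0) (schurAlternant_zero_ne_zero n) ?_ ?_
    schurAlternant_mul_schurPoly (fun h => by rw [schurPoly, if_neg h])
    schurAlternant_mul_schurPoly (fun h => by rw [schurPoly, if_neg h])
  · intro a ha
    rw [hmap, alt_succ _ (fun i => X i + C 0) _ _ _ _ _ a ha, schurAlternant_eq]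
    · congr 1
      refine Finset.prod_congr rfl fun i _ => ?_
      rw [map_add, setLastZero_X_castSucc, setLastZero_C]
    · rw [map_add, setLastZero_X_last, setLastZero_C]; simp
    · simp
    · intro m; simp
    · intro m i
      rw [map_add, setLastZero_X_castSucc, setLastZero_C]
      simp [pow_succ']
  · intro a ha
    rw [hmap]
    apply alt_succ_eq_zero _ _ _ _ _ ha
    · rw [map_add, setLastZero_X_last, setLastZero_C]; simp
    · intro m; simp

theorem setLastZero_shiftedSchurPoly (n : ℕ) (μ : YoungDiagram) :
    setLastZero n (shiftedSchurPoly (n + 1) μ) = shiftedSchurPoly n μ := by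
  have hmap : ∀ a, setLastZero n (shiftedAlternant (n + 1) a) =
      alt (fun m => (descPochhammer ℚ m).map (C : ℚ →+* MvPolynomial (Fin n) ℚ))
        (fun i : Fin (n + 1) => setLastZero n (X i + C ((i.rev : ℕ) : ℚ))) a := by
    intro a
    rw [shiftedAlternant_eq]
    have := map_alt (setLastZero n : MvPolynomial (Fin (n + 1)) ℚ →+* MvPolynomial (Fin n) ℚ)
      (fun m => (descPochhammer ℚ m).map (C : ℚ →+* MvPolynomial (Fin (n + 1)) ℚ))
      (fun i => X i + C ((i.rev : ℕ) : ℚ)) a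
    simp only [map_C_setLastZero] at this
    exact this
  have hrev : ∀ i : Fin n, (((Fin.castSucc i).rev : Fin (n + 1)) : ℕ) = (i.rev : ℕ) + 1 := by
    intro i
    have := i.isLt
    simp only [Fin.val_rev, Fin.val_castSucc]
    omega
  have hz : ∀ m, ((descPochhammer ℚ (m + 1)).map
      (C : ℚ →+* MvPolynomial (Fin n) ℚ)).eval 0 = 0 := by
    intro m
    rw [descPochhammer_map, descPochhammer_succ_left]
    simp
  refine stable_of_alternants μ (shiftedAlternant (n + 1)) (shiftedAlternant n) _ _
    (∏ i, (X i + C (((i.rev : ℕ) + 1 : ℕ) : ℚ))) (prod_X_add_C_ne_zero _)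
    (shiftedAlternant_zero_ne_zero n) ?_ ?_
    shiftedAlternant_mul_shiftedSchurPoly (fun h => by rw [shiftedSchurPoly, if_neg h])
    shiftedAlternant_mul_shiftedSchurPoly (fun h => by rw [shiftedSchurPoly, if_neg h])
  · intro a ha
    rw [hmap, alt_succ _ (fun i => X i + C ((i.rev : ℕ) : ℚ)) _ _ _ hz _ a ha,
      shiftedAlternant_eq]
    · congr 1
      refine Finset.prod_congr rfl fun i _ => ?_
      rw [map_add, setLastZero_X_castSucc, setLastZero_C, hrev]
    · rw [map_add, setLastZero_X_last, setLastZero_C]; simp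
    · simp
    · intro m i
      rw [map_add, setLastZero_X_castSucc, setLastZero_C, hrev, descPochhammer_map,
        descPochhammer_succ_left, descPochhammer_map, Polynomial.eval_mul, Polynomial.eval_X,
        Polynomial.eval_comp]
      congr 2
      simp
      ring
  · intro a ha
    rw [hmap]
    apply alt_succ_eq_zero _ _ _ hz _ ha
    rw [map_add, setLastZero_X_last, setLastZero_C]; simp

theorem eval_eq_of_stable (P : ∀ n, MvPolynomial (Fin n) ℚ)
    (hP : ∀ n, setLastZero n (P (n + 1)) = P n) (x : ℕ → ℚ) {m n : ℕ} (hmn : m ≤ n)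
    (hx : ∀ i, m ≤ i → x i = 0) :
    eval (fun i : Fin n => x i) (P n) = eval (fun i : Fin m => x i) (P m) := by
  induction n, hmn using Nat.le_induction with
  | base => rfl
  | succ n hn ih => rw [← ih, ← hP n, eval_setLastZero x (hx n hn)]

end Stability

/-! ### Schur functions and shifted Schur functions

Both are functions of infinitely many variables, evaluated at a sequence with finitely many
nonzero entries through the polynomial in any sufficiently large number of variables. -/

/-- A number of leading entries of `x` after which all entries are zero. -/
def bound (x : ℕ →₀ ℚ) : ℕ := x.support.sup Nat.succ

theorem eq_zero_of_bound_le (x : ℕ →₀ ℚ) {i : ℕ} (h : bound x ≤ i) : x i = 0 := by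
  by_contra hx
  have := Finset.le_sup (f := Nat.succ) (Finsupp.mem_support_iff.mpr hx)
  unfold bound at h
  omega

/-- The value `s_μ(x_1, x_2, …)` of the Schur function. -/
def schur (μ : YoungDiagram) (x : ℕ →₀ ℚ) : ℚ :=
  MvPolynomial.eval (fun i : Fin (bound x) => x i) (schurPoly (bound x) μ)

/-- The value `s*_μ(x_1, x_2, …)` of the shifted Schur function. -/
def shiftedSchur (μ : YoungDiagram) (x : ℕ →₀ ℚ) : ℚ :=
  MvPolynomial.eval (fun i : Fin (bound x) => x i) (shiftedSchurPoly (bound x) μ)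

/-- Any number of variables beyond which `x` vanishes gives the same value. -/
theorem schur_eq_eval (μ : YoungDiagram) (x : ℕ →₀ ℚ) (n : ℕ) (hn : ∀ i, n ≤ i → x i = 0) :
    schur μ x = MvPolynomial.eval (fun i : Fin n => x i) (schurPoly n μ) := by
  rcases le_total (bound x) n with h | h
  · exact (eval_eq_of_stable (fun n => schurPoly n μ) (fun n => setLastZero_schurPoly n μ) x h
      (fun i hi => eq_zero_of_bound_le x hi)).symm
  · exact eval_eq_of_stable (fun n => schurPoly n μ) (fun n => setLastZero_schurPoly n μ) x h hn

/-- Any number of variables beyond which `x` vanishes gives the same value. -/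
theorem shiftedSchur_eq_eval (μ : YoungDiagram) (x : ℕ →₀ ℚ) (n : ℕ)
    (hn : ∀ i, n ≤ i → x i = 0) :
    shiftedSchur μ x = MvPolynomial.eval (fun i : Fin n => x i) (shiftedSchurPoly n μ) := by
  rcases le_total (bound x) n with h | h
  · exact (eval_eq_of_stable (fun n => shiftedSchurPoly n μ)
      (fun n => setLastZero_shiftedSchurPoly n μ) x h
      (fun i hi => eq_zero_of_bound_le x hi)).symm
  · exact eval_eq_of_stable (fun n => shiftedSchurPoly n μ)
      (fun n => setLastZero_shiftedSchurPoly n μ) x h hn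

/-- The sequence `{a}^k`: `k` copies of `a`, followed by zeros. -/
def copies (k : ℕ) (a : ℚ) : ℕ →₀ ℚ := Finsupp.indicator (Finset.range k) fun _ _ => a

end ShiftedSchur

end

/-!
Write `V(l) = ∏_{i < j} (l_j - l_i)` for the Vandermonde product and put `ρ = (n - 1, …, 1, 0)`.
With `n = k` variables and `μ` of at most `k` rows, everything reduces to `V(μ + ρ) / V(ρ)`.

* `eval_one_schurPoly_mul`: `s_μ(1, …, 1) = V(μ + ρ) / V(ρ)`, because at `x_i = X ^ (n - i)` the
  transposed alternants are Vandermonde determinants in powers of `X`; then let `X` tend to `1`.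
* `eval_const_shiftedSchurPoly_mul`: `s*_μ(N, …, N) = ∏ (N - c(□)) V(μ + ρ) / V(ρ)`. Indeed
  `(N + m) ↓ l = (N + m)! / (N + n - 1 - l)! * ((N + n - 1 - l) ↓ (n - 1 - m))`, so once row and
  column factors are removed, the shifted alternants are Vandermonde determinants as well. The column
  factors of numerator and denominator have the quotient `∏ (N - c(□))`.
* `prod_card_hook_row_mul`: the hook lengths in row `i` and the differences `l_i - l_j`, `j > i`,
  of the entries of `l = μ + ρ` fill `{1, …, l_i}`. Hence `V(μ + ρ) / V(ρ) = ∏ (k + c(□)) / h_μ`,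
  which with the first item gives the hook-content formula `schur_copies_one`.

The three expressions agree by the hook-content formula for `μ` and for its conjugate, as
conjugation preserves hook lengths and changes the signs of contents. If `μ` has more than `k` rows,
all of them vanish.
-/

namespace ShiftedSchur

/-! ### The Schur polynomial at `(1, …, 1)` -/

/-- Under the principal specialization `x_i = X ^ (n - i)` the transposed alternant is again an
alternant, of Vandermonde type, in the variables `X ^ (a_j + n - j)`. -/
theorem map_schurAlternant_eq (n : ℕ) (a : ℕ → ℕ) :
    MvPolynomial.aeval (fun i : Fin n => (Polynomial.X : Polynomial ℚ) ^ (i.rev : ℕ))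
        (schurAlternant n a) =
      alt (fun m => Polynomial.X ^ m)
        (fun j : Fin n => (Polynomial.X : Polynomial ℚ) ^ (a j + (j.rev : ℕ))) (fun _ => 0) := by
  unfold schurAlternant alt
  rw [AlgHom.map_det, ← Matrix.det_transpose]
  congr 1
  ext1 i j
  simp [← pow_mul, mul_comm]

theorem det_vandermonde_X_pow (n : ℕ) (l : Fin n → ℕ) :
    Matrix.det (Matrix.vandermonde fun j => (Polynomial.X : Polynomial ℚ) ^ l j) =
      (∏ i : Fin n, ∏ _j ∈ Finset.Ioi i, (Polynomial.X - 1)) *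
        Matrix.det (Matrix.vandermonde fun j =>
          ∑ t ∈ Finset.range (l j), (Polynomial.X : Polynomial ℚ) ^ t) := by
  simp_rw [Matrix.det_vandermonde, ← Finset.prod_mul_distrib]
  refine Finset.prod_congr rfl fun i _ => Finset.prod_congr rfl fun j _ => ?_
  rw [mul_sub, mul_geom_sum, mul_geom_sum]
  ring

/-- Weyl's dimension formula, as `s_μ(1, …, 1) V(ρ) = V(μ + ρ)` with `V` the Vandermonde product
and `ρ = (n - 1, …, 1, 0)`. Both alternants vanish at `(1, …, 1)`, so the value is reached through
the principal specialization: equal powers of `X - 1` cancel before `X = 1` is substituted. -/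
theorem eval_one_schurPoly_mul {n : ℕ} {μ : YoungDiagram} (h : μ.colLen 0 ≤ n) :
    MvPolynomial.eval (fun _ => 1) (schurPoly n μ) *
        Matrix.det (Matrix.vandermonde fun j : Fin n => ((j.rev : ℕ) : ℚ)) =
      Matrix.det (Matrix.vandermonde fun j : Fin n => ((μ.rowLen j + (j.rev : ℕ) : ℕ) : ℚ)) := by
  set φ := MvPolynomial.aeval (R := ℚ)
    (fun i : Fin n => (Polynomial.X : Polynomial ℚ) ^ (i.rev : ℕ)) with hφ
  have e := congrArg φ (schurAlternant_mul_schurPoly h)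
  have hsign : (((Equiv.Perm.sign (Fin.revPerm : Equiv.Perm (Fin n)) : ℤ) : Polynomial ℚ)) ≠ 0 := by
    rcases Int.units_eq_one_or (Equiv.Perm.sign (Fin.revPerm : Equiv.Perm (Fin n))) with h | h <;>
      simp [h]
  have hX : (∏ i : Fin n, ∏ _j ∈ Finset.Ioi i, (Polynomial.X - 1 : Polynomial ℚ)) ≠ 0 := by
    have : (Polynomial.X - 1 : Polynomial ℚ) ≠ 0 := by
      simpa using Polynomial.X_sub_C_ne_zero (1 : ℚ)
    exact Finset.prod_ne_zero_iff.mpr fun i _ => Finset.prod_ne_zero_iff.mpr fun j _ => this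
  rw [map_mul, hφ, map_schurAlternant_eq, map_schurAlternant_eq,
    alt_zero _ Polynomial.monic_X_pow Polynomial.natDegree_X_pow,
    alt_zero _ Polynomial.monic_X_pow Polynomial.natDegree_X_pow,
    det_vandermonde_X_pow, det_vandermonde_X_pow, ← hφ, mul_assoc, mul_assoc] at e
  have e' := congrArg (Polynomial.evalRingHom (1 : ℚ)) (mul_left_cancel₀ hX
    (mul_left_cancel₀ hsign e))
  have hev : Polynomial.evalRingHom (1 : ℚ) (φ (schurPoly n μ)) =
      MvPolynomial.eval (fun _ => 1) (schurPoly n μ) := by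
    have : (Polynomial.evalRingHom (1 : ℚ)).comp (φ : MvPolynomial (Fin n) ℚ →+* Polynomial ℚ) =
        MvPolynomial.eval (fun _ => 1) := by
      ext i <;> simp [hφ]
    exact DFunLike.congr_fun this _
  have hdet : ∀ l : Fin n → ℕ, Polynomial.evalRingHom (1 : ℚ)
      (Matrix.det (Matrix.vandermonde fun j =>
          ∑ t ∈ Finset.range (l j), (Polynomial.X : Polynomial ℚ) ^ t)) =
      Matrix.det (Matrix.vandermonde fun j => (l j : ℚ)) := by
    intro l
    rw [Matrix.det_vandermonde, Matrix.det_vandermonde]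
    simp [Polynomial.eval_finsetSum]
  rw [map_mul, hev, hdet, hdet, mul_comm] at e'
  simpa using e'

/-! ### The shifted Schur polynomial at `(N, …, N)` -/

theorem det_vandermonde_const_sub (n : ℕ) (v : Fin n → ℚ) (c : ℚ) :
    Matrix.det (Matrix.vandermonde fun j => c - v j) =
      (∏ i : Fin n, ∏ _j ∈ Finset.Ioi i, (-1)) * Matrix.det (Matrix.vandermonde v) := by
  simp_rw [Matrix.det_vandermonde, ← Finset.prod_mul_distrib]
  refine Finset.prod_congr rfl fun i _ => Finset.prod_congr rfl fun j _ => ?_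
  ring

/-- With `l` as column index, this turns `(N + m) ↓ l`, up to a factor depending on `m` only and one
depending on `l` only, into the value at `N + n - 1 - l` of a monic polynomial of degree
`n - 1 - m`. -/
theorem descFactorial_mul_factorial {N n m l : ℕ} (hm : m < n) (hl : l ≤ N + n - 1) :
    (N + m).descFactorial l * (N + n - 1 - l).factorial =
      (N + m).factorial * (N + n - 1 - l).descFactorial (n - 1 - m) := by
  rcases le_or_gt l (N + m) with h | h
  · have h1 := Nat.factorial_mul_descFactorial h
    have h2 := Nat.factorial_mul_descFactorial (n := N + n - 1 - l) (k := n - 1 - m) (by omega)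
    rw [show N + n - 1 - l - (n - 1 - m) = N + m - l by omega] at h2
    rw [← h1, ← h2]
    ring
  · rw [Nat.descFactorial_of_lt h, Nat.descFactorial_of_lt (by omega)]
    simp

theorem eval_eval_descPochhammer {n : ℕ} (i : Fin n) (N m l : ℕ) :
    MvPolynomial.eval (fun _ => (N : ℚ)) ((descPochhammer (MvPolynomial (Fin n) ℚ) l).eval
      (MvPolynomial.X i + (m : MvPolynomial (Fin n) ℚ))) = ((N + m).descFactorial l : ℚ) := by
  rw [← descPochhammer_eval_eq_descFactorial, ← Polynomial.eval₂_at_apply,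
    ← Polynomial.eval_map, descPochhammer_map]
  simp

/-- The shifted alternant at `(N, …, N)` is, up to row and column factors, a Vandermonde determinant
in the numbers `N + n - 1 - (a_j + n - j)`. The bound on `a` keeps these from being truncated. -/
theorem eval_shiftedAlternant {n : ℕ} (a : ℕ → ℕ) (N : ℕ)
    (ha : ∀ j : Fin n, a j + (j.rev : ℕ) ≤ N + n - 1) :
    MvPolynomial.eval (fun _ => (N : ℚ)) (shiftedAlternant n a) *
        ∏ j : Fin n, ((N + n - 1 - (a j + (j.rev : ℕ))).factorial : ℚ) =
      (∏ i : Fin n, ((N + (i.rev : ℕ)).factorial : ℚ)) *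
        ((∏ i : Fin n, ∏ _j ∈ Finset.Ioi i, (-1)) *
          Matrix.det (Matrix.vandermonde fun j : Fin n => ((a j + (j.rev : ℕ) : ℕ) : ℚ))) := by
  have hv := Matrix.det_eval_matrixOfPolynomials_eq_det_vandermonde
    (fun j : Fin n => ((N + n - 1 : ℕ) : ℚ) - ((a j + (j.rev : ℕ) : ℕ) : ℚ))
    (fun i => descPochhammer ℚ i) (fun i => descPochhammer_natDegree ℚ i)
    (fun i => monic_descPochhammer ℚ i)
  rw [← det_vandermonde_const_sub _ _ ((N + n - 1 : ℕ) : ℚ), hv, ← Matrix.det_transpose,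
    ← Matrix.det_mul_column, mul_comm, shiftedAlternant, RingHom.map_det, ← Matrix.det_mul_row]
  congr 1
  ext i j
  have hi : (i : ℕ) = n - 1 - (i.rev : ℕ) := by
    have := i.isLt
    rw [Fin.val_rev]
    omega
  have key := descFactorial_mul_factorial (N := N) (n := n) (m := (i.rev : ℕ)) (i.rev).isLt (ha j)
  rw [← hi] at key
  simp only [RingHom.mapMatrix_apply, Matrix.map_apply, Matrix.of_apply, Matrix.transpose_apply]
  rw [eval_eval_descPochhammer, ← Nat.cast_sub (ha j), descPochhammer_eval_eq_descFactorial, mul_comm]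
  exact_mod_cast key

/-- A product over the boxes of a diagram, taken row by row; `n` may exceed the number of rows. -/
theorem prod_cells_eq {M : Type*} [CommMonoid M] {n : ℕ} {μ : YoungDiagram} (h : μ.colLen 0 ≤ n)
    (f : ℕ × ℕ → M) :
    ∏ c ∈ μ.cells, f c = ∏ i : Fin n, ∏ j ∈ Finset.range (μ.rowLen i), f (i, j) := by
  rw [Fin.prod_univ_eq_prod_range (fun i => ∏ j ∈ Finset.range (μ.rowLen i), f (i, j)) n]
  refine Finset.prod_finset_product _ _ _ fun c => ?_
  rw [YoungDiagram.mem_cells, Finset.mem_range, Finset.mem_range,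
    ← YoungDiagram.mem_iff_lt_rowLen]
  refine ⟨fun hc => ⟨?_, hc⟩, fun hc => hc.2⟩
  have := YoungDiagram.mem_iff_lt_colLen.mp (μ.up_left_mem le_rfl (Nat.zero_le c.2) hc)
  omega

theorem det_vandermonde_rev_ne_zero (n : ℕ) :
    Matrix.det (Matrix.vandermonde fun j : Fin n => ((j.rev : ℕ) : ℚ)) ≠ 0 := by
  rw [Matrix.det_vandermonde_ne_zero_iff]
  intro i j hij
  exact Fin.rev_injective (Fin.ext (Nat.cast_injective (R := ℚ) hij))

theorem eval_shiftedAlternant_zero_ne_zero (n N : ℕ) :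
    MvPolynomial.eval (fun _ => (N : ℚ)) (shiftedAlternant n fun _ => 0) ≠ 0 := by
  have h := eval_shiftedAlternant (n := n) (fun _ => 0) N (fun j => by rw [Fin.val_rev]; omega)
  intro h0
  rw [h0, zero_mul, eq_comm] at h
  simp only [zero_add] at h
  refine mul_ne_zero ?_ (mul_ne_zero ?_ (det_vandermonde_rev_ne_zero n)) h
  · exact Finset.prod_ne_zero_iff.mpr fun i _ => by positivity
  · simp [Finset.prod_ne_zero_iff]

theorem factorial_eq_mul_prod_sub {N i r : ℕ} (hr : r ≤ N) :
    ((N + i).factorial : ℚ) =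
      ((N + i - r).factorial : ℚ) * ∏ j ∈ Finset.range r, ((N : ℚ) - (content (i, j) : ℚ)) := by
  rw [← Nat.factorial_mul_descFactorial (show r ≤ N + i by omega), Nat.cast_mul,
    Nat.descFactorial_eq_prod_range, Nat.cast_prod]
  congr 1
  refine Finset.prod_congr rfl fun j hj => ?_
  rw [Finset.mem_range] at hj
  rw [Nat.cast_sub (by omega)]
  simp only [content]
  push_cast
  ring

/-- Unlike the Schur alternants, the denominator of `s*_μ` does not vanish at `(N, …, N)`, so the
quotient is computed directly. -/
theorem eval_const_shiftedSchurPoly_mul {n : ℕ} {μ : YoungDiagram} (h : μ.colLen 0 ≤ n) (N : ℕ) :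
    MvPolynomial.eval (fun _ => (N : ℚ)) (shiftedSchurPoly n μ) *
        Matrix.det (Matrix.vandermonde fun j : Fin n => ((j.rev : ℕ) : ℚ)) =
      (∏ c ∈ μ.cells, ((N : ℚ) - (content c : ℚ))) *
        Matrix.det (Matrix.vandermonde fun j : Fin n =>
          ((μ.rowLen j + (j.rev : ℕ) : ℕ) : ℚ)) := by
  have e := congrArg (MvPolynomial.eval fun _ => (N : ℚ)) (shiftedAlternant_mul_shiftedSchurPoly h)
  rw [map_mul] at e
  rcases le_or_gt (μ.rowLen 0) N with hN | hN
  · have hle : ∀ j, μ.rowLen j ≤ N := fun j => (μ.rowLen_anti _ _ (Nat.zero_le j)).trans hN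
    have e0 := eval_shiftedAlternant (n := n) (fun _ => 0) N (fun j => by rw [Fin.val_rev]; omega)
    have e1 := eval_shiftedAlternant (n := n) μ.rowLen N
      (fun j => by have := hle j; rw [Fin.val_rev]; omega)
    have hfac : ∏ j : Fin n, ((N + n - 1 - (0 + (j.rev : ℕ))).factorial : ℚ) =
        (∏ j : Fin n, ((N + n - 1 - (μ.rowLen j + (j.rev : ℕ))).factorial : ℚ)) *
          ∏ c ∈ μ.cells, ((N : ℚ) - (content c : ℚ)) := by
      rw [prod_cells_eq h, ← Finset.prod_mul_distrib]
      refine Finset.prod_congr rfl fun j _ => ?_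
      have hj := j.isLt
      have := hle j
      rw [show N + n - 1 - (0 + (j.rev : ℕ)) = N + j by rw [Fin.val_rev]; omega,
        show N + n - 1 - (μ.rowLen j + (j.rev : ℕ)) = N + j - μ.rowLen j by
          rw [Fin.val_rev]; omega]
      exact factorial_eq_mul_prod_sub this
    rw [hfac] at e0
    simp only [zero_add] at e0
    have hF : (∏ j : Fin n, ((N + (j.rev : ℕ)).factorial : ℚ)) ≠ 0 :=
      Finset.prod_ne_zero_iff.mpr fun i _ => by positivity
    have hε : (∏ i : Fin n, ∏ _j ∈ Finset.Ioi i, (-1 : ℚ)) ≠ 0 := by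
      simp [Finset.prod_ne_zero_iff]
    refine mul_left_cancel₀ (mul_ne_zero hF hε) ?_
    rw [← e] at e1
    linear_combination (-MvPolynomial.eval (fun _ => (N : ℚ)) (shiftedSchurPoly n μ)) * e0 +
      (∏ c ∈ μ.cells, ((N : ℚ) - (content c : ℚ))) * e1
  -- If `μ_1 > N`, the box of content `N` in the first row makes the right side vanish, and the first
  -- column of the numerator vanishes too.
  · have hmem : (0, N) ∈ μ.cells := by
      rwa [YoungDiagram.mem_cells, YoungDiagram.mem_iff_lt_rowLen]
    have hn : 0 < n := by
      have := (rowLen_ne_zero_iff μ 0).mp (by omega)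
      omega
    rw [Finset.prod_eq_zero hmem (by simp [content]), zero_mul]
    have h0 : MvPolynomial.eval (fun _ => (N : ℚ)) (shiftedAlternant n μ.rowLen) = 0 := by
      rw [shiftedAlternant, RingHom.map_det]
      apply Matrix.det_eq_zero_of_column_eq_zero (⟨0, hn⟩ : Fin n)
      intro i
      rw [RingHom.mapMatrix_apply, Matrix.map_apply, Matrix.of_apply, eval_eval_descPochhammer,
        Nat.descFactorial_of_lt, Nat.cast_zero]
      simp only [Fin.val_rev]
      omega
    rw [h0] at e
    rw [(mul_eq_zero.mp e).resolve_left (eval_shiftedAlternant_zero_ne_zero n N), zero_mul]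

/-! ### Hook lengths -/

theorem card_hook_transpose (μ : YoungDiagram) (c : ℕ × ℕ) :
    (hook μ.transpose c.swap).card = (hook μ c).card := by
  refine Finset.card_bij' (fun d _ => d.swap) (fun d _ => d.swap) ?_ ?_ ?_ ?_ <;>
    simp [hook] <;> tauto

theorem prod_cells_transpose {M : Type*} [CommMonoid M] (μ : YoungDiagram) (f : ℕ × ℕ → M) :
    ∏ c ∈ μ.transpose.cells, f c = ∏ c ∈ μ.cells, f c.swap := by
  refine Finset.prod_bij' (fun c _ => c.swap) (fun c _ => c.swap) ?_ ?_ ?_ ?_ ?_ <;> simp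

theorem hookNumber_transpose (μ : YoungDiagram) : hookNumber μ.transpose = hookNumber μ := by
  unfold hookNumber
  rw [prod_cells_transpose]
  exact Finset.prod_congr rfl fun c _ => card_hook_transpose μ c

/-- The hook length is the arm length plus the leg length plus one. -/
theorem card_hook {μ : YoungDiagram} {i j : ℕ} (h : j < μ.rowLen i) :
    (hook μ (i, j)).card + i + j + 1 = μ.rowLen i + μ.colLen j := by
  have hi : i < μ.colLen j := by
    rwa [← YoungDiagram.mem_iff_lt_colLen, YoungDiagram.mem_iff_lt_rowLen]
  have h1 : hook μ (i, j) = (Finset.Ico j (μ.rowLen i)).image (fun t => (i, t)) ∪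
      (Finset.Ioo i (μ.colLen j)).image (fun t => (t, j)) := by
    ext ⟨a, b⟩
    simp only [hook, Finset.mem_union, Finset.mem_filter, YoungDiagram.mem_cells,
      Finset.mem_image, Finset.mem_Ico, Finset.mem_Ioo, Prod.mk.injEq]
    constructor
    · rintro (⟨hm, rfl, hb⟩ | ⟨hm, rfl, ha⟩)
      · exact Or.inl ⟨b, ⟨hb, YoungDiagram.mem_iff_lt_rowLen.mp hm⟩, rfl, rfl⟩
      · rcases ha.eq_or_lt with rfl | ha
        · exact Or.inl ⟨b, ⟨le_rfl, h⟩, rfl, rfl⟩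
        · exact Or.inr ⟨a, ⟨ha, YoungDiagram.mem_iff_lt_colLen.mp hm⟩, rfl, rfl⟩
    · rintro (⟨t, ⟨h1, h2⟩, rfl, rfl⟩ | ⟨t, ⟨h1, h2⟩, rfl, rfl⟩)
      · exact Or.inl ⟨YoungDiagram.mem_iff_lt_rowLen.mpr h2, rfl, h1⟩
      · exact Or.inr ⟨YoungDiagram.mem_iff_lt_colLen.mpr h2, rfl, h1.le⟩
  rw [h1, Finset.card_union_of_disjoint, Finset.card_image_of_injective,
    Finset.card_image_of_injective, Nat.card_Ico, Nat.card_Ioo]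
  · omega
  · intro a b hab; simpa using hab
  · intro a b hab; simpa using hab
  · rw [Finset.disjoint_left]
    simp only [Finset.mem_image, Finset.mem_Ico, Finset.mem_Ioo]
    rintro c ⟨t, ht, rfl⟩ ⟨s, hs, hst⟩
    rw [Prod.mk.injEq] at hst
    omega

/-- The hook lengths in row `i` and the differences `l_i - l_j` for `i < j < n`, where
`l_j = μ_j + n - 1 - j`, are together the numbers `1, …, l_i`, each once. -/
theorem prod_card_hook_row_mul {n : ℕ} {μ : YoungDiagram} (h : μ.colLen 0 ≤ n) {i : ℕ}
    (hi : i < n) :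
    (∏ j ∈ Finset.range (μ.rowLen i), (hook μ (i, j)).card) *
        ∏ j ∈ Finset.Ioo i n, (μ.rowLen i + j - (μ.rowLen j + i)) =
      (μ.rowLen i + (n - 1 - i)).factorial := by
  have hcol : ∀ j, μ.colLen j ≤ n := fun j => (μ.colLen_anti _ _ (Nat.zero_le j)).trans h
  have hrow : ∀ {j}, i < j → μ.rowLen j ≤ μ.rowLen i := fun hj => μ.rowLen_anti _ _ hj.le
  have hcr : ∀ {a b}, a < μ.colLen b ↔ b < μ.rowLen a := fun {a b} => by
    rw [← YoungDiagram.mem_iff_lt_colLen, YoungDiagram.mem_iff_lt_rowLen]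
  have inj1 : Set.InjOn (fun j => (hook μ (i, j)).card) (Finset.range (μ.rowLen i)) := by
    have : StrictAntiOn (fun j => (hook μ (i, j)).card) (Finset.range (μ.rowLen i)) := by
      intro a ha b hb hab
      simp only [Finset.coe_range, Set.mem_Iio] at ha hb
      have h1 := card_hook ha
      have h2 := card_hook hb
      have h3 := μ.colLen_anti _ _ hab.le
      show (hook μ (i, b)).card < (hook μ (i, a)).card
      omega
    exact this.injOn
  have inj2 : Set.InjOn (fun j => μ.rowLen i + j - (μ.rowLen j + i)) (Finset.Ioo i n) := by
    have : StrictMonoOn (fun j => μ.rowLen i + j - (μ.rowLen j + i)) (Finset.Ioo i n) := by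
      intro a ha b hb hab
      simp only [Finset.coe_Ioo, Set.mem_Ioo] at ha hb
      have h1 := hrow ha.1
      have h2 := hrow hb.1
      have h3 := μ.rowLen_anti _ _ hab.le
      show μ.rowLen i + a - (μ.rowLen a + i) < μ.rowLen i + b - (μ.rowLen b + i)
      omega
    exact this.injOn
  have hdisj : Disjoint ((Finset.range (μ.rowLen i)).image fun j => (hook μ (i, j)).card)
      ((Finset.Ioo i n).image fun j => μ.rowLen i + j - (μ.rowLen j + i)) := by
    rw [Finset.disjoint_left]
    simp only [Finset.mem_image, Finset.mem_range, Finset.mem_Ioo]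
    rintro _ ⟨a, ha, rfl⟩ ⟨b, hb, hab⟩
    have h1 := card_hook ha
    have h2 := hrow hb.1
    -- Equality would force `μ_b + μ'_a = a + b + 1`, but `b < μ'_a` and `a < μ_b` hold or fail together.
    have h3 := hcr (a := b) (b := a)
    omega
  rw [← Finset.prod_image (f := fun x => x) inj1, ← Finset.prod_image (f := fun x => x) inj2,
    ← Finset.prod_union hdisj, ← Finset.prod_Ico_id_eq_factorial]
  refine Finset.prod_congr (Finset.eq_of_subset_of_card_le ?_ ?_) fun _ _ => rfl
  · intro x
    simp only [Finset.mem_union, Finset.mem_image, Finset.mem_range, Finset.mem_Ioo,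
      Finset.mem_Ico]
    rintro (⟨a, ha, rfl⟩ | ⟨b, hb, rfl⟩)
    · have h1 := card_hook ha
      have h2 := hcol a
      have h3 := hcr.mpr ha
      omega
    · have := hrow hb.1
      omega
  · rw [Finset.card_union_of_disjoint hdisj, Finset.card_image_of_injOn inj1,
      Finset.card_image_of_injOn inj2, Finset.card_range, Nat.card_Ioo, Nat.card_Ico]
    omega

theorem hookNumber_mul_det_vandermonde {n : ℕ} {μ : YoungDiagram} (h : μ.colLen 0 ≤ n) :
    (hookNumber μ : ℚ) * Matrix.det (Matrix.vandermonde fun j : Fin n =>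
          ((μ.rowLen j + (j.rev : ℕ) : ℕ) : ℚ)) =
      (∏ i : Fin n, ∏ _j ∈ Finset.Ioi i, (-1)) *
        ∏ i : Fin n, ((μ.rowLen i + (i.rev : ℕ)).factorial : ℚ) := by
  rw [hookNumber, prod_cells_eq h, Matrix.det_vandermonde, Nat.cast_prod,
    ← Finset.prod_mul_distrib, ← Finset.prod_mul_distrib]
  refine Finset.prod_congr rfl fun i _ => ?_
  have hrev : (i.rev : ℕ) = n - 1 - i := by rw [Fin.val_rev]; omega
  rw [hrev, ← prod_card_hook_row_mul h i.isLt, Nat.cast_mul, mul_left_comm]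
  congr 1
  rw [← Fin.map_valEmbedding_Ioi, Finset.prod_map, Nat.cast_prod, ← Finset.prod_mul_distrib]
  refine Finset.prod_congr rfl fun j hj => ?_
  rw [Finset.mem_Ioi, Fin.lt_def] at hj
  have h1 := μ.rowLen_anti _ _ hj.le
  have h2 := j.isLt
  rw [Fin.valEmbedding_apply, Nat.cast_sub (by omega), Fin.val_rev, ← hrev, Fin.val_rev]
  push_cast [Nat.cast_sub (show (j : ℕ) + 1 ≤ n by omega),
    Nat.cast_sub (show (i : ℕ) + 1 ≤ n by omega)]
  ring

theorem factorial_mul_prod_add {n i : ℕ} (hi : i < n) (r : ℕ) :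
    ((r + (n - 1 - i)).factorial : ℚ) =
      ((n - 1 - i).factorial : ℚ) * ∏ j ∈ Finset.range r, ((n : ℚ) + (content (i, j) : ℚ)) := by
  rw [add_comm, ← Nat.factorial_mul_ascFactorial, Nat.cast_mul,
    Nat.ascFactorial_eq_prod_range, Nat.cast_prod]
  congr 1
  refine Finset.prod_congr rfl fun j _ => ?_
  rw [show n - 1 - i + 1 + j = n + j - i by omega, Nat.cast_sub (by omega)]
  simp only [content]
  push_cast
  ring

/-- The hook formula `V(μ + ρ) / V(ρ) = ∏ (n + c(□)) / h_μ`. The denominator `V(ρ)` comes from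
the preceding formula for the empty diagram. -/
theorem hookNumber_mul_det_vandermonde_eq_risingProd {n : ℕ} {μ : YoungDiagram}
    (h : μ.colLen 0 ≤ n) :
    (hookNumber μ : ℚ) * Matrix.det (Matrix.vandermonde fun j : Fin n =>
          ((μ.rowLen j + (j.rev : ℕ) : ℕ) : ℚ)) =
      risingProd n μ * Matrix.det (Matrix.vandermonde fun j : Fin n => ((j.rev : ℕ) : ℚ)) := by
  have hrow : ∀ j, (⊥ : YoungDiagram).rowLen j = 0 := fun j => by
    by_contra hj
    exact YoungDiagram.notMem_bot (j, 0)
      (YoungDiagram.mem_iff_lt_rowLen.mpr (Nat.pos_of_ne_zero hj))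
  have hcol : (⊥ : YoungDiagram).colLen 0 ≤ n := by
    by_contra hj
    exact YoungDiagram.notMem_bot (0, 0)
      (YoungDiagram.mem_iff_lt_colLen.mpr (by omega))
  have h0 := hookNumber_mul_det_vandermonde hcol
  simp only [hrow, zero_add, hookNumber, YoungDiagram.cells_bot, Finset.prod_empty, Nat.cast_one,
    one_mul] at h0
  rw [hookNumber_mul_det_vandermonde h, h0, risingProd, prod_cells_eq h, mul_left_comm]
  congr 1
  rw [← Finset.prod_mul_distrib]
  refine Finset.prod_congr rfl fun i _ => ?_
  have hrev : (i.rev : ℕ) = n - 1 - i := by rw [Fin.val_rev]; omega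
  rw [hrev, factorial_mul_prod_add i.isLt, mul_comm]

theorem hookNumber_ne_zero (μ : YoungDiagram) : (hookNumber μ : ℚ) ≠ 0 := by
  rw [Nat.cast_ne_zero, hookNumber, Finset.prod_ne_zero_iff]
  intro c hc
  rw [Finset.card_ne_zero]
  rw [YoungDiagram.mem_cells] at hc
  exact ⟨c, by simp [hook, hc]⟩

/-! ### Evaluation at constant sequences -/

theorem copies_apply_of_lt {k i : ℕ} (a : ℚ) (h : i < k) : copies k a i = a := by
  simp [copies, Finsupp.indicator_apply, h]

theorem copies_apply_of_le {k i : ℕ} (a : ℚ) (h : k ≤ i) : copies k a i = 0 := by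
  simp [copies, Finsupp.indicator_apply, h]

theorem schur_copies (μ : YoungDiagram) (k : ℕ) (a : ℚ) :
    schur μ (copies k a) = MvPolynomial.eval (fun _ => a) (schurPoly k μ) := by
  rw [schur_eq_eval μ _ k fun i hi => copies_apply_of_le a hi]
  congr 2
  ext i
  exact copies_apply_of_lt a i.isLt

theorem shiftedSchur_copies (μ : YoungDiagram) (k : ℕ) (a : ℚ) :
    shiftedSchur μ (copies k a) = MvPolynomial.eval (fun _ => a) (shiftedSchurPoly k μ) := by
  rw [shiftedSchur_eq_eval μ _ k fun i hi => copies_apply_of_le a hi]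
  congr 2
  ext i
  exact copies_apply_of_lt a i.isLt

/-- The hook-content formula. If `μ` has more than `k` rows, both sides vanish, the right one because
of the box of content `-k`. -/
theorem schur_copies_one (μ : YoungDiagram) (k : ℕ) :
    schur μ (copies k 1) = risingProd k μ / hookNumber μ := by
  rw [schur_copies, eq_div_iff (hookNumber_ne_zero μ)]
  by_cases h : μ.colLen 0 ≤ k
  · refine mul_right_cancel₀ (det_vandermonde_rev_ne_zero k) ?_
    rw [← hookNumber_mul_det_vandermonde_eq_risingProd h, ← eval_one_schurPoly_mul h]
    ring
  · have hmem : (k, 0) ∈ μ.cells := by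
      rw [YoungDiagram.mem_cells, YoungDiagram.mem_iff_lt_colLen]
      omega
    rw [schurPoly, if_neg h, risingProd, Finset.prod_eq_zero hmem (by simp [content])]
    simp

theorem shiftedSchur_copies_natCast (μ : YoungDiagram) (N k : ℕ) :
    shiftedSchur μ (copies k N) =
      (∏ c ∈ μ.cells, ((N : ℚ) - (content c : ℚ))) * schur μ (copies k 1) := by
  rw [schur_copies, shiftedSchur_copies]
  by_cases h : μ.colLen 0 ≤ k
  · refine mul_right_cancel₀ (det_vandermonde_rev_ne_zero k) ?_
    rw [eval_const_shiftedSchurPoly_mul h, mul_assoc, eval_one_schurPoly_mul h]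
  · rw [schurPoly, shiftedSchurPoly, if_neg h, if_neg h]
    simp

theorem risingProd_transpose (z : ℚ) (μ : YoungDiagram) :
    risingProd z μ.transpose = ∏ c ∈ μ.cells, (z - (content c : ℚ)) := by
  rw [risingProd, prod_cells_transpose]
  refine Finset.prod_congr rfl fun c _ => ?_
  simp only [content, Prod.fst_swap, Prod.snd_swap]
  push_cast
  ring

theorem neg_one_pow_card_mul_risingProd_neg (z : ℚ) (μ : YoungDiagram) :
    (-1) ^ μ.card * risingProd (-z) μ = ∏ c ∈ μ.cells, (z - (content c : ℚ)) := by
  rw [risingProd, YoungDiagram.card, ← Finset.prod_const, ← Finset.prod_mul_distrib]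
  exact Finset.prod_congr rfl fun c _ => by ring

end ShiftedSchur

theorem lemma2 (μ : YoungDiagram) (N k : ℕ) :
    ShiftedSchur.shiftedSchur μ (ShiftedSchur.copies k N) =
        (ShiftedSchur.hookNumber μ : ℚ) *
          ShiftedSchur.schur μ.transpose (ShiftedSchur.copies N 1) *
          ShiftedSchur.schur μ (ShiftedSchur.copies k 1) ∧
      ShiftedSchur.shiftedSchur μ (ShiftedSchur.copies k N) =
        (-1) ^ μ.card *
          (ShiftedSchur.risingProd (-N) μ * ShiftedSchur.risingProd k μ /
            (ShiftedSchur.hookNumber μ : ℚ)) ∧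
      ShiftedSchur.shiftedSchur μ (ShiftedSchur.copies k N) =
        (∏ c ∈ μ.cells, ((N : ℚ) - (ShiftedSchur.content c : ℚ))) *
          ShiftedSchur.schur μ (ShiftedSchur.copies k 1) := by
  have h := ShiftedSchur.shiftedSchur_copies_natCast μ N k
  refine ⟨?_, ?_, h⟩
  · rw [h, ShiftedSchur.schur_copies_one μ.transpose, ShiftedSchur.hookNumber_transpose,
      ShiftedSchur.risingProd_transpose,
      mul_div_cancel₀ _ (ShiftedSchur.hookNumber_ne_zero μ)]
  · rw [h, ShiftedSchur.schur_copies_one, ← ShiftedSchur.neg_one_pow_card_mul_risingProd_neg]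
    ring
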